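/- **Conventions.** Let $R$ be an associative ring with identity and $\delta$ a derivation of $R$ (an additive map with $\delta(ab)=\delta(a)b+a\delta(b)$); "ideal" means two-sided ideal. The ring $R((x^{-1};\delta))$ consists of the formal series $\sum_{i=-\infty}^{n}a_ix^i$ ($n\in\mathbb Z$, $a_i\in R$) with the usual addition and the multiplication determined by $xa=ax+\delta(a)$ and $x^{-1}a=\sum_{i\ge 0}(-1)^i\delta^i(a)x^{-i-1}$. For an ideal $I$ of $R$, $I((x^{-1};\delta))$ is the set of series all of whose coefficients lie in $I$. An ideal $I$ is a $\delta$-ideal if $\delta(I)\subseteq I$; then $\bar\delta$ denotes the induced derivation of $R/I$. A subset $S$ of a ring is left T-nilpotent if for every sequence $s_1,s_2,\ldots$ in $S$ there is $k\ge 1$ with $s_1s_2\cdots s_k=0$. For a ring $A$, $\mathcal I_l(A)$ is the sum of all left T-nilpotent ideals of $A$, and the higher left T-nilpotent radideals are defined by $\mathcal I_l^{(0)}(A)=0$, $\mathcal I_l^{(\beta+1)}(A)=\{a\in A: a+\mathcal I_l^{(\beta)}(A)\in \mathcal I_l(A/\mathcal I_l^{(\beta)}(A))\}$, and $\mathcal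 I_l^{(\alpha)}(A)=\bigcup_{\beta<\alpha}\mathcal I_l^{(\beta)}(A)$ for limit ordinals $\alpha$. Similarly, $\mathcal I_{l,\delta}(R)=\{a\in R:\sum_{j\ge 0}\delta^j(a)R\text{ is left T-nilpotent}\}$, and $\delta$-ideals $\mathcal I_{l,\delta}^{(\alpha)}(R)$ are defined by $\mathcal I_{l,\delta}^{(0)}(R)=0$, $\mathcal I_{l,\delta}^{(\beta+1)}(R)=\{a\in R: a+\mathcal I_{l,\delta}^{(\beta)}(R)\in \mathcal I_{l,\bar\delta}(R/\mathcal I_{l,\delta}^{(\beta)}(R))\}$, and $\mathcal I_{l,\delta}^{(\alpha)}(R)=\bigcup_{\beta<\alpha}\mathcal I_{l,\delta}^{(\beta)}(R)$ for limit ordinals $\alpha$. **Proposition.** Let $R$ be a left or right Noetherian ring with a derivation $\delta$. Then for every ordinal $\alpha$, $$\mathcal I_l^{(\alpha)}\big(R((x^{-1};\delta))\big)=\mathcal I_{l,\delta}^{(\alpha)}(R)((x^{-1};\delta)).$$ -/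

import Mathlib

universe u v

/-- A derivation of a (not necessarily commutative) ring `R`: an additive map `δ : R → R` with
`δ (a * b) = δ a * b + a * δ b`. -/
structure RingDerivation (R : Type u) [Ring R] extends R →+ R where
  leibniz' : ∀ a b : R, toFun (a * b) = toFun a * b + a * toFun b

namespace RingDerivation

open Finset

variable {R : Type u} [Ring R]

instance : FunLike (RingDerivation R) R R where
  coe δ := δ.toFun
  coe_injective := by
    rintro ⟨⟨⟨f, _⟩, _⟩, _⟩ ⟨⟨⟨g, _⟩, _⟩, _⟩ h
    congr

instance : AddMonoidHomClass (RingDerivation R) R R where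
  map_add δ := δ.toAddMonoidHom.map_add
  map_zero δ := δ.toAddMonoidHom.map_zero

variable (δ : RingDerivation R)

theorem leibniz (a b : R) : δ (a * b) = δ a * b + a * δ b := δ.leibniz' a b

theorem map_one : δ 1 = 0 := by
  have h := δ.leibniz 1 1
  simpa using h

theorem iterate_map_zero (n : ℕ) : δ^[n] 0 = 0 :=
  Function.iterate_fixed (map_zero δ) n

theorem iterate_map_add (n : ℕ) (a b : R) : δ^[n] (a + b) = δ^[n] a + δ^[n] b := by
  induction n generalizing a b with
  | zero => rfl
  | succ n ih => simp [Function.iterate_succ_apply, ih]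

/-- The `n`-th iterate of `δ` as an additive map. -/
def iter (n : ℕ) : R →+ R where
  toFun := δ^[n]
  map_zero' := δ.iterate_map_zero n
  map_add' := δ.iterate_map_add n

theorem iter_apply (n : ℕ) (a : R) : δ.iter n a = δ^[n] a := rfl

/-- The Leibniz rule for iterates of a derivation. -/
theorem iterate_mul (n : ℕ) (a b : R) :
    δ^[n] (a * b) =
      ∑ x ∈ antidiagonal n, (n.choose x.1 : ℤ) • (δ^[x.1] a * δ^[x.2] b) := by
  induction n with
  | zero => simp
  | succ n ih =>
    have key := Finset.sum_antidiagonal_choose_succ_nsmul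
      (fun i j => δ^[i] a * δ^[j] b) n
    simp only [natCast_zsmul] at ih ⊢
    rw [key, Function.iterate_succ_apply', ih, map_sum]
    simp only [map_nsmul, leibniz, smul_add, sum_add_distrib, ← Function.iterate_succ_apply' (⇑δ)]
    rw [add_comm]
    congr 1
    refine sum_congr rfl fun x hx => ?_
    rw [n.choose_symm_of_eq_add (HasAntidiagonal.mem_antidiagonal.1 hx).symm]

end RingDerivation

/-- Formal series `∑_{i ≤ n} a_i x^i` (`n` an integer, infinitely many negative exponents allowed)
with coefficients `a_i = coeff i` in `R`: the elements of the ring `R((x⁻¹; δ))` of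
pseudo-differential operators. -/
@[ext]
structure PseudoDiffOp {R : Type u} [Ring R] (δ : RingDerivation R) where
  coeff : ℤ → R
  bdd : ∃ n : ℤ, ∀ i, n < i → coeff i = 0

namespace PseudoDiffOp

open Finset Function

variable {R : Type u} [Ring R] {δ : RingDerivation R}

/-- The contribution of `a_i x^i` and of `b_j x^j`, where `j = m - i + k`, to the coefficient of
`x^m` in a product, coming from `x^i b = ∑_k (i choose k) δ^k(b) x^(i-k)`. -/
def mulTerm (δ : RingDerivation R) (f g : ℤ → R) (m : ℤ) (p : ℤ × ℕ) : R :=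
  Ring.choose p.1 p.2 • (f p.1 * δ^[p.2] (g (m - p.1 + p.2)))

theorem mulTerm_finite {f g : ℤ → R} (hf : ∃ n : ℤ, ∀ i, n < i → f i = 0)
    (hg : ∃ n : ℤ, ∀ i, n < i → g i = 0) (m : ℤ) :
    HasFiniteSupport (mulTerm δ f g m) := by
  obtain ⟨F, hF⟩ := hf
  obtain ⟨G, hG⟩ := hg
  refine Set.Finite.subset
    ((Set.finite_Icc (m - G) F).prod (Set.finite_Iic (G + F - m).toNat)) ?_
  rintro ⟨i, k⟩ h
  rw [Function.mem_support] at h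
  have h1 : i ≤ F := by
    by_contra hc
    exact h (by simp [mulTerm, hF i (by omega)])
  have h2 : m - i + k ≤ G := by
    by_contra hc
    exact h (by simp [mulTerm, hG (m - i + k) (by omega), δ.iterate_map_zero])
  simp only [Set.mem_prod, Set.mem_Icc, Set.mem_Iic]
  omega

instance : Zero (PseudoDiffOp δ) := ⟨⟨fun _ => 0, 0, fun _ _ => rfl⟩⟩

/-- The constant series `1 = 1 x^0`. -/
instance : One (PseudoDiffOp δ) :=
  ⟨⟨fun i => if i = 0 then 1 else 0, 0, fun i hi => if_neg (by omega)⟩⟩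

instance : Add (PseudoDiffOp δ) :=
  ⟨fun f g => ⟨fun i => f.coeff i + g.coeff i, by
    obtain ⟨F, hF⟩ := f.bdd
    obtain ⟨G, hG⟩ := g.bdd
    exact ⟨max F G, fun i hi => by
      rw [hF i (lt_of_le_of_lt (le_max_left _ _) hi),
        hG i (lt_of_le_of_lt (le_max_right _ _) hi), add_zero]⟩⟩⟩

instance : Neg (PseudoDiffOp δ) :=
  ⟨fun f => ⟨fun i => -f.coeff i, by
    obtain ⟨F, hF⟩ := f.bdd
    exact ⟨F, fun i hi => by rw [hF i hi, neg_zero]⟩⟩⟩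

/-- Multiplication is determined by `x^i b = ∑_{k ≥ 0} (i choose k) δ^k(b) x^(i-k)` for every
integer `i`, with `i choose k = i (i-1) ⋯ (i-k+1) / k!`. For `i = 1` and `i = -1` these are the
relations `x b = b x + δ(b)` and `x⁻¹ b = ∑_{k ≥ 0} (-1)^k δ^k(b) x^(-k-1)`. The sum over `(i, k)`
that gives the coefficient of `x^m` has only finitely many nonzero terms. -/
noncomputable instance : Mul (PseudoDiffOp δ) :=
  ⟨fun f g => ⟨fun m => ∑ᶠ p : ℤ × ℕ, mulTerm δ f.coeff g.coeff m p, by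
    obtain ⟨F, hF⟩ := f.bdd
    obtain ⟨G, hG⟩ := g.bdd
    refine ⟨F + G, fun m hm => ?_⟩
    rw [← finsum_zero (α := ℤ × ℕ) (M := R)]
    refine finsum_congr ?_
    rintro ⟨i, k⟩
    by_cases hi : F < i
    · simp [mulTerm, hF i hi]
    · simp [mulTerm, hG (m - i + k) (by omega), δ.iterate_map_zero]⟩⟩

theorem coeff_zero (i : ℤ) : (0 : PseudoDiffOp δ).coeff i = 0 := rfl
theorem coeff_one (i : ℤ) : (1 : PseudoDiffOp δ).coeff i = if i = 0 then 1 else 0 := rfl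
theorem coeff_add (f g : PseudoDiffOp δ) (i : ℤ) :
    (f + g).coeff i = f.coeff i + g.coeff i := rfl
theorem coeff_neg (f : PseudoDiffOp δ) (i : ℤ) : (-f).coeff i = -f.coeff i := rfl
theorem coeff_mul (f g : PseudoDiffOp δ) (m : ℤ) :
    (f * g).coeff m = ∑ᶠ p : ℤ × ℕ, mulTerm δ f.coeff g.coeff m p := rfl

theorem finsum_antidiagonal {M : Type*} [AddCommMonoid M] (H : ℕ × ℕ → M)
    (hH : HasFiniteSupport H) :
    ∑ᶠ l : ℕ, ∑ x ∈ antidiagonal l, H x = ∑ᶠ x, H x := by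
  have hH' : (Function.support H).Finite := hH
  set N := (hH'.toFinset.sup fun x => x.1 + x.2) + 1 with hN
  have hb : ∀ x, H x ≠ 0 → x.1 + x.2 < N := by
    intro x hx
    have : x.1 + x.2 ≤ hH'.toFinset.sup fun x => x.1 + x.2 :=
      Finset.le_sup (f := fun x : ℕ × ℕ => x.1 + x.2) (by simpa using hx)
    omega
  rw [finsum_eq_sum_of_support_subset (s := range N),
    finsum_eq_sum_of_support_subset (s := (range N).biUnion antidiagonal) H,
    Finset.sum_biUnion]
  · intro a _ b _ hab
    rw [Function.onFun, Finset.disjoint_left]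
    intro x hx hx'
    simp only [HasAntidiagonal.mem_antidiagonal] at hx hx'
    omega
  · intro x hx
    simpa using hb x hx
  · intro l hl
    obtain ⟨x, hx, hx'⟩ := Finset.exists_ne_zero_of_sum_ne_zero hl
    have := hb x hx'
    simp only [HasAntidiagonal.mem_antidiagonal] at hx
    simp
    omega

theorem finite_prod_antidiagonal {α M : Type*} [AddCommMonoid M] (H : α → ℕ × ℕ → M)
    (hH : HasFiniteSupport fun p : α × (ℕ × ℕ) => H p.1 p.2) :
    HasFiniteSupport fun q : α × ℕ => ∑ x ∈ antidiagonal q.2, H q.1 x := by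
  have hH' : (Function.support fun p : α × (ℕ × ℕ) => H p.1 p.2).Finite := hH
  refine Set.Finite.subset (hH'.image fun p => (p.1, p.2.1 + p.2.2)) ?_
  rintro ⟨a, l⟩ h
  obtain ⟨x, hx, hx'⟩ := Finset.exists_ne_zero_of_sum_ne_zero h
  exact ⟨(a, x), hx', by simpa using hx⟩

theorem finsum_prod_antidiagonal {α M : Type*} [AddCommMonoid M] (H : α → ℕ × ℕ → M)
    (hH : HasFiniteSupport fun p : α × (ℕ × ℕ) => H p.1 p.2) :
    ∑ᶠ q : α × ℕ, ∑ x ∈ antidiagonal q.2, H q.1 x = ∑ᶠ p : α × (ℕ × ℕ), H p.1 p.2 := by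
  rw [finsum_curry _ hH, finsum_curry _ (finite_prod_antidiagonal H hH)]
  refine finsum_congr fun a => finsum_antidiagonal (H a) ?_
  exact Function.support_along_fiber_finite_of_finite _ a hH

theorem finite_comp_equiv {α β M : Type*} [AddCommMonoid M] (e : α ≃ β) (f : β → M)
    (hf : HasFiniteSupport f) : HasFiniteSupport fun a => f (e a) :=
  Set.Finite.preimage (f := e) e.injective.injOn hf

/-- The common summand in the two expansions of a triple product. -/
def tripleTerm (δ : RingDerivation R) (f g h : ℤ → R) (m j i : ℤ) (k r q : ℕ) : R :=
  (Ring.choose j k * Ring.choose (j - k) r * Ring.choose i q) •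
    (f j * δ^[k] (g i) * δ^[r + q] (h (m - j - i + k + r + q)))

theorem tripleTerm_finite {f g h : ℤ → R} (hf : ∃ n : ℤ, ∀ i, n < i → f i = 0)
    (hg : ∃ n : ℤ, ∀ i, n < i → g i = 0) (hh : ∃ n : ℤ, ∀ i, n < i → h i = 0) (m : ℤ) :
    HasFiniteSupport fun p : (ℤ × ℤ × ℕ) × (ℕ × ℕ) =>
      tripleTerm δ f g h m p.1.1 p.1.2.1 p.1.2.2 p.2.1 p.2.2 := by
  obtain ⟨F, hF⟩ := hf
  obtain ⟨G, hG⟩ := hg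
  obtain ⟨H, hH⟩ := hh
  refine Set.Finite.subset
    (((Set.finite_Icc (m - G - H) F).prod ((Set.finite_Icc (m - F - H) G).prod
      (Set.finite_Iic (F + G + H - m).toNat))).prod
      ((Set.finite_Iic (F + G + H - m).toNat).prod (Set.finite_Iic (F + G + H - m).toNat))) ?_
  rintro ⟨⟨j, i, k⟩, r, q⟩ hne
  rw [Function.mem_support] at hne
  have h1 : j ≤ F := by
    by_contra hc
    exact hne (by simp [tripleTerm, hF j (by omega)])
  have h2 : i ≤ G := by
    by_contra hc
    exact hne (by simp [tripleTerm, hG i (by omega), δ.iterate_map_zero])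
  have h3 : m - j - i + k + r + q ≤ H := by
    by_contra hc
    exact hne (by
      simp only [tripleTerm]
      rw [hH (m - j - i + k + r + q) (by omega), δ.iterate_map_zero, mul_zero, smul_zero])
  simp only [Set.mem_prod, Set.mem_Icc, Set.mem_Iic]
  omega

def leftEquiv : (ℤ × ℕ) × (ℤ × ℕ) ≃ (ℤ × ℤ × ℕ) × ℕ where
  toFun p := ((p.2.1, p.1.1 - p.2.1 + p.2.2, p.2.2), p.1.2)
  invFun p := ((p.1.2.1 + p.1.1 - p.1.2.2, p.2), (p.1.1, p.1.2.2))
  left_inv := by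
    rintro ⟨⟨i, l⟩, j, k⟩
    simp only [Prod.mk.injEq, and_true]
    omega
  right_inv := by
    rintro ⟨⟨j, i, k⟩, l⟩
    simp only [Prod.mk.injEq, and_true, true_and]
    omega

def rightEquiv : (ℤ × ℕ) × (ℤ × ℕ) ≃ (ℤ × ℤ × ℕ) × ℕ where
  toFun p := ((p.1.1, p.2.1, p.2.2), p.1.2)
  invFun p := ((p.1.1, p.2), (p.1.2.1, p.1.2.2))

def swapEquiv : (ℤ × ℤ × ℕ) × (ℕ × ℕ) ≃ (ℤ × ℤ × ℕ) × (ℕ × ℕ) where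
  toFun p := ((p.1.1, p.1.2.1, p.2.1), (p.2.2, p.1.2.2))
  invFun p := ((p.1.1, p.1.2.1, p.2.2), (p.1.2.2, p.2.1))

theorem left_expand (f g h : ℤ → R) (m i j : ℤ) (k l : ℕ) :
    Ring.choose i l • (mulTerm δ f g i (j, k) * δ^[l] (h (m - i + l))) =
      ∑ x ∈ antidiagonal l, tripleTerm δ f g h m j (i - j + k) k x.1 x.2 := by
  have hc := Ring.add_choose_eq (r := j - k) (s := i - j + k) l (Commute.all _ _)
  rw [show j - k + (i - j + k) = i by ring] at hc
  rw [hc, sum_smul]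
  refine sum_congr rfl fun x hx => ?_
  have hx := HasAntidiagonal.mem_antidiagonal.1 hx
  subst hx
  simp only [mulTerm, tripleTerm]
  rw [smul_mul_assoc, smul_smul]
  congr 1
  · ring
  · congr 3
    push_cast
    ring

theorem right_expand (f g h : ℤ → R) (m i j : ℤ) (p q : ℕ) :
    Ring.choose j p • (f j * δ^[p] (mulTerm δ g h (m - j + p) (i, q))) =
      ∑ x ∈ antidiagonal p, tripleTerm δ f g h m j i x.1 x.2 q := by
  simp only [mulTerm]
  rw [← δ.iter_apply, map_zsmul, δ.iter_apply, δ.iterate_mul, smul_sum, mul_sum, smul_sum]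
  refine sum_congr rfl fun x hx => ?_
  have hx := HasAntidiagonal.mem_antidiagonal.1 hx
  subst hx
  have hc := Ring.choose_smul_choose j (Nat.le_add_right x.1 x.2)
  rw [Nat.add_sub_cancel_left, nsmul_eq_mul] at hc
  simp only [tripleTerm]
  rw [← hc, mul_smul_comm, mul_smul_comm, smul_smul, smul_smul, mul_assoc,
    ← Function.iterate_add_apply]
  congr 1
  · ring
  · rw [show m - j - i + (x.1 : ℤ) + (x.2 : ℤ) + (q : ℤ) = m - j + ((x.1 + x.2 : ℕ) : ℤ) - i + q by
      push_cast; ring, mul_assoc]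

protected theorem mul_assoc (f g h : PseudoDiffOp δ) : f * g * h = f * (g * h) := by
  ext m
  obtain ⟨T, hT⟩ : ∃ T, T = tripleTerm δ f.coeff g.coeff h.coeff m := ⟨_, rfl⟩
  have hfin : HasFiniteSupport fun p : (ℤ × ℤ × ℕ) × (ℕ × ℕ) =>
      T p.1.1 p.1.2.1 p.1.2.2 p.2.1 p.2.2 := by
    rw [hT]
    exact tripleTerm_finite (δ := δ) f.bdd g.bdd h.bdd m
  let A : ℤ × ℤ × ℕ → ℕ × ℕ → R := fun a x => T a.1 a.2.1 a.2.2 x.1 x.2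
  let B : ℤ × ℤ × ℕ → ℕ × ℕ → R := fun a x => T a.1 a.2.1 x.1 x.2 a.2.2
  have hfin' : HasFiniteSupport fun p : (ℤ × ℤ × ℕ) × (ℕ × ℕ) =>
      T p.1.1 p.1.2.1 p.2.1 p.2.2 p.1.2.2 :=
    finite_comp_equiv swapEquiv _ hfin
  have hL : (f * g * h).coeff m = ∑ᶠ p : (ℤ × ℤ × ℕ) × (ℕ × ℕ),
      T p.1.1 p.1.2.1 p.1.2.2 p.2.1 p.2.2 := by
    refine Eq.trans ?_ (finsum_prod_antidiagonal A hfin)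
    rw [← finsum_comp_equiv leftEquiv, finsum_curry]
    · rw [coeff_mul]
      refine finsum_congr ?_
      rintro ⟨i, l⟩
      have hfg := mulTerm_finite (δ := δ) f.bdd g.bdd i
      have h1 := finsum_mul' (mulTerm δ f.coeff g.coeff i) (δ^[l] (h.coeff (m - i + l))) hfg
      have h2 : HasFiniteSupport fun p =>
          mulTerm δ f.coeff g.coeff i p * δ^[l] (h.coeff (m - i + l)) :=
        hfg.subset fun p hp hp' => hp (by
          show mulTerm δ f.coeff g.coeff i p * _ = 0
          rw [hp', zero_mul])
      rw [mulTerm, coeff_mul, h1, smul_finsum' _ h2]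
      subst hT
      exact finsum_congr fun p => left_expand _ _ _ m i p.1 p.2 l
    · exact finite_comp_equiv leftEquiv _ (finite_prod_antidiagonal A hfin)
  have hR : (f * (g * h)).coeff m = ∑ᶠ p : (ℤ × ℤ × ℕ) × (ℕ × ℕ),
      T p.1.1 p.1.2.1 p.1.2.2 p.2.1 p.2.2 := by
    rw [← finsum_comp_equiv swapEquiv]
    refine Eq.trans ?_
      (finsum_prod_antidiagonal B hfin')
    rw [← finsum_comp_equiv rightEquiv, finsum_curry]
    · rw [coeff_mul]
      refine finsum_congr ?_
      rintro ⟨j, p⟩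
      have hgh := mulTerm_finite (δ := δ) g.bdd h.bdd (m - j + p)
      have h0 := map_finsum (δ.iter p) hgh
      have h1 : HasFiniteSupport fun x => δ.iter p (mulTerm δ g.coeff h.coeff (m - j + p) x) :=
        hgh.subset fun x hx hx' => hx (by
          show δ.iter p (mulTerm δ g.coeff h.coeff (m - j + p) x) = 0
          rw [hx', map_zero])
      have h2 := mul_finsum' _ (f.coeff j) h1
      have h3 : HasFiniteSupport fun x =>
          f.coeff j * δ.iter p (mulTerm δ g.coeff h.coeff (m - j + p) x) :=
        h1.subset fun x hx hx' => hx (by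
          have hx'' : δ.iter p (mulTerm δ g.coeff h.coeff (m - j + p) x) = 0 := hx'
          show f.coeff j * δ.iter p (mulTerm δ g.coeff h.coeff (m - j + p) x) = 0
          rw [hx'', mul_zero])
      rw [mulTerm, coeff_mul, ← δ.iter_apply, h0, h2, smul_finsum' _ h3]
      subst hT
      exact finsum_congr fun x => right_expand _ _ _ m x.1 j p x.2
    · exact finite_comp_equiv rightEquiv _ (finite_prod_antidiagonal B hfin')
  rw [hL, hR]

noncomputable instance : Ring (PseudoDiffOp δ) where
  add_assoc f g h := by ext i; simp only [coeff_add]; abel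
  zero_add f := by ext i; simp only [coeff_add, coeff_zero, zero_add]
  add_zero f := by ext i; simp only [coeff_add, coeff_zero, add_zero]
  add_comm f g := by ext i; simp only [coeff_add]; abel
  neg_add_cancel f := by ext i; simp only [coeff_add, coeff_neg, coeff_zero, neg_add_cancel]
  nsmul := nsmulRec
  zsmul := zsmulRec
  mul_assoc := PseudoDiffOp.mul_assoc
  left_distrib f g h := by
    ext m
    rw [coeff_add, coeff_mul, coeff_mul, coeff_mul,
      ← finsum_add_distrib (mulTerm_finite f.bdd g.bdd m) (mulTerm_finite f.bdd h.bdd m)]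
    refine finsum_congr fun p => ?_
    simp only [mulTerm, coeff_add, δ.iterate_map_add, mul_add, smul_add]
  right_distrib f g h := by
    ext m
    rw [coeff_add, coeff_mul, coeff_mul, coeff_mul,
      ← finsum_add_distrib (mulTerm_finite f.bdd h.bdd m) (mulTerm_finite g.bdd h.bdd m)]
    refine finsum_congr fun p => ?_
    simp only [mulTerm, coeff_add, add_mul, smul_add]
  zero_mul f := by
    ext m
    rw [coeff_mul, coeff_zero, ← finsum_zero (α := ℤ × ℕ) (M := R)]
    refine finsum_congr fun p => ?_
    simp only [mulTerm, coeff_zero, zero_mul, smul_zero]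
  mul_zero f := by
    ext m
    rw [coeff_mul, coeff_zero, ← finsum_zero (α := ℤ × ℕ) (M := R)]
    refine finsum_congr fun p => ?_
    simp only [mulTerm, coeff_zero, δ.iterate_map_zero, mul_zero, smul_zero]
  one_mul f := by
    ext m
    rw [coeff_mul, finsum_eq_single _ (0, 0)]
    · simp [mulTerm, coeff_one]
    · rintro ⟨i, k⟩ h
      by_cases hi : i = 0
      · subst hi
        have hk : 0 < k := Nat.pos_of_ne_zero fun hk => h (by rw [hk])
        simp only [mulTerm]
        rw [Ring.choose_zero_pos ℤ hk, zero_smul]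
      · simp [mulTerm, coeff_one, hi]
  mul_one f := by
    ext m
    rw [coeff_mul, finsum_eq_single _ (m, 0)]
    · simp [mulTerm, coeff_one]
    · rintro ⟨i, k⟩ h
      by_cases hi : m - i + k = 0
      · have hk : k ≠ 0 := fun hk => h (by simp; omega)
        obtain ⟨k, rfl⟩ := Nat.exists_eq_succ_of_ne_zero hk
        simp only [mulTerm, coeff_one, hi, if_true, Function.iterate_succ_apply, δ.map_one,
          δ.iterate_map_zero, mul_zero, smul_zero]
      · simp only [mulTerm, coeff_one, hi, if_false, δ.iterate_map_zero, mul_zero, smul_zero]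

end PseudoDiffOp

/-- A subset `S` of a ring is left T-nilpotent if for every sequence `s₀, s₁, …` in `S` there is
`k ≥ 1` with `s₀ s₁ ⋯ s_{k-1} = 0`. -/
def IsLeftTNilpotent {R : Type u} [Ring R] (S : Set R) : Prop :=
  ∀ s : ℕ → R, (∀ i, s i ∈ S) → ∃ k : ℕ, 1 ≤ k ∧ ((List.range k).map s).prod = 0

/-- The left T-nilpotent radideal: the sum of all left T-nilpotent two-sided ideals. -/
def leftTNilRadideal (R : Type u) [Ring R] : TwoSidedIdeal R :=
  sSup {I : TwoSidedIdeal R | IsLeftTNilpotent (I : Set R)}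

/-- The higher left T-nilpotent radideals, by transfinite recursion: `0` at `0`; at `β + 1` the
preimage in `R` of the left T-nilpotent radideal of the quotient of `R` by the `β`-th one; at a
limit ordinal the supremum of the earlier ones, which is their union
(`mem_higherRadideal_limit`). -/
noncomputable def higherRadideal (R : Type u) [Ring R] (α : Ordinal.{v}) : TwoSidedIdeal R :=
  Ordinal.limitRecOn α ⊥
    (fun _ I => TwoSidedIdeal.comap I.ringCon.mk' (leftTNilRadideal I.ringCon.Quotient))
    (fun β _ ih => ⨆ (γ : Ordinal.{v}) (h : γ < β), ih γ h)

/-- A `δ`-ideal: a two-sided ideal `I` with `δ(I) ⊆ I`. -/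
structure DeltaIdeal {R : Type u} [Ring R] (δ : RingDerivation R) where
  ideal : TwoSidedIdeal R
  map_mem : ∀ a ∈ ideal, δ a ∈ ideal

section Radideal

variable {R : Type u} [Ring R]

theorem IsLeftTNilpotent.mono {S T : Set R} (hT : IsLeftTNilpotent T) (h : S ⊆ T) :
    IsLeftTNilpotent S := fun s hs => hT s fun i => h (hs i)

theorem IsLeftTNilpotent.descent {S : Set R} (hS : IsLeftTNilpotent S) (Q : R → Prop)
    (h : ∀ x, Q x → ∃ s ∈ S, Q (x * s)) (x : R) (hx : Q x) : Q 0 := by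
  choose! t ht hQ using h
  let p : ℕ → R := fun n => Nat.rec x (fun _ y => y * t y) n
  have hp : ∀ n, Q (p n) := by
    intro n
    induction n with
    | zero => exact hx
    | succ n ih => exact hQ _ ih
  have hprod : ∀ n, p n = x * ((List.range n).map fun i => t (p i)).prod := by
    intro n
    induction n with
    | zero => simp [p]
    | succ n ih =>
      rw [List.range_succ, List.map_append, List.prod_append, ← mul_assoc, ← ih]
      simp [p]
  obtain ⟨k, -, hk⟩ := hS (fun i => t (p i)) fun i => ht _ (hp i)
  have h0 := hp k
  rwa [hprod, hk, mul_zero] at h0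

/-- The elements `x` such that every sequence in `S` has a finite product killed by `x`. -/
def annSeq (S : Set R) : Set R :=
  {x | ∀ s : ℕ → R, (∀ i, s i ∈ S) → ∃ k : ℕ, x * ((List.range k).map s).prod = 0}

theorem zero_mem_annSeq (S : Set R) : (0 : R) ∈ annSeq S := fun _ _ => ⟨0, zero_mul _⟩

theorem add_mem_annSeq {S : Set R} {x y : R} (hx : x ∈ annSeq S) (hy : y ∈ annSeq S) :
    x + y ∈ annSeq S := by
  have key : ∀ (s : ℕ → R) (z : R) (k l : ℕ), k ≤ l →
      z * ((List.range k).map s).prod = 0 → z * ((List.range l).map s).prod = 0 := by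
    intro s z k l hkl hk
    obtain ⟨d, rfl⟩ := Nat.exists_eq_add_of_le hkl
    rw [List.range_add, List.map_append, List.prod_append, ← mul_assoc, hk, zero_mul]
  intro s hs
  obtain ⟨k, hk⟩ := hx s hs
  obtain ⟨l, hl⟩ := hy s hs
  exact ⟨max k l, by
    rw [add_mul, key s x k _ (le_max_left _ _) hk, key s y l _ (le_max_right _ _) hl, add_zero]⟩

theorem neg_mem_annSeq {S : Set R} {x : R} (hx : x ∈ annSeq S) : -x ∈ annSeq S := by
  intro s hs
  obtain ⟨k, hk⟩ := hx s hs
  exact ⟨k, by rw [neg_mul, hk, neg_zero]⟩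

theorem mem_annSeq_of_mul {S : Set R} {x : R} (h : ∀ s ∈ S, x * s ∈ annSeq S) :
    x ∈ annSeq S := by
  intro s hs
  obtain ⟨k, hk⟩ := h (s 0) (hs 0) (fun i => s (i + 1)) fun i => hs _
  refine ⟨k + 1, ?_⟩
  rw [List.range_succ_eq_map, List.map_cons, List.prod_cons, List.map_map, ← mul_assoc]
  exact hk

theorem isLeftTNilpotent_of_one_mem {S : Set R} (h : (1 : R) ∈ annSeq S) :
    IsLeftTNilpotent S := by
  intro s hs
  obtain ⟨k, hk⟩ := h s hs
  rw [one_mul] at hk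
  exact ⟨k + 1, by omega, by
    rw [List.range_succ, List.map_append, List.prod_append, hk, zero_mul]⟩

theorem mul_mem_annSeq (K : TwoSidedIdeal R) {x : R} (hx : x ∈ annSeq (K : Set R)) (r : R) :
    x * r ∈ annSeq (K : Set R) := by
  refine mem_annSeq_of_mul fun s hs => ?_
  intro t ht
  obtain ⟨k, hk⟩ := hx (fun i => Nat.casesOn i (r * s) t) (by
    rintro (_ | i)
    · exact K.mul_mem_left _ _ hs
    · exact ht i)
  refine ⟨k, ?_⟩
  have hk' : x * ((List.range (k + 1)).map fun i => (Nat.casesOn i (r * s) t : R)).prod = 0 := by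
    rw [List.range_succ, List.map_append, List.prod_append, ← mul_assoc, hk, zero_mul]
  rw [List.range_succ_eq_map, List.map_cons, List.prod_cons, List.map_map, ← mul_assoc] at hk'
  simpa [mul_assoc, Function.comp_def] using hk'

/-- The sum of two left T-nilpotent ideals is left T-nilpotent. -/
theorem IsLeftTNilpotent.sup {K L : TwoSidedIdeal R} (hK : IsLeftTNilpotent (K : Set R))
    (hL : IsLeftTNilpotent (L : Set R)) : IsLeftTNilpotent ((K ⊔ L : TwoSidedIdeal R) : Set R) := by
  apply isLeftTNilpotent_of_one_mem
  by_contra h1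
  refine hK.descent (fun x => x ∉ annSeq ((K ⊔ L : TwoSidedIdeal R) : Set R)) ?_ 1 h1
    (zero_mem_annSeq _)
  intro x hx
  by_contra! hc
  refine (hL.descent (fun z => z ∉ annSeq ((K ⊔ L : TwoSidedIdeal R) : Set R) ∧
    ∀ y ∈ K, z * y ∈ annSeq ((K ⊔ L : TwoSidedIdeal R) : Set R)) ?_ x
    ⟨hx, fun y hy => hc y hy⟩).1 (zero_mem_annSeq _)
  rintro z ⟨hz, hzK⟩
  by_contra! hd
  refine hz (mem_annSeq_of_mul fun s hs => ?_)
  obtain ⟨y, hy, w, hw, rfl⟩ := TwoSidedIdeal.mem_sup.1 hs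
  rw [mul_add]
  refine add_mem_annSeq (hzK y hy) ?_
  by_contra hzw
  obtain ⟨y', hy', hy''⟩ := hd w hw hzw
  exact hy'' (by rw [mul_assoc]; exact hzK _ (K.mul_mem_left _ _ hy'))

/-- The two-sided ideal generated by a left T-nilpotent right ideal is left T-nilpotent. -/
theorem IsLeftTNilpotent.span {J : Submodule Rᵐᵒᵖ R} (hJ : IsLeftTNilpotent (J : Set R)) :
    IsLeftTNilpotent (TwoSidedIdeal.span (J : Set R) : Set R) := by
  have step : ∀ x, x ∉ annSeq (TwoSidedIdeal.span (J : Set R) : Set R) →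
      ∃ r, ∃ y ∈ J, x * r * y ∉ annSeq (TwoSidedIdeal.span (J : Set R) : Set R) := by
    intro x hx
    by_contra! hc
    refine hx (mem_annSeq_of_mul fun s hs => ?_)
    have hs' := TwoSidedIdeal.mem_span_iff_mem_addSubgroup_closure.1 hs
    induction hs' using AddSubgroup.closure_induction with
    | mem z hz =>
      obtain ⟨w, ⟨a, -, y, hy, rfl⟩, b, -, rfl⟩ := hz
      have h1 := hc a (y * b) (J.smul_mem (MulOpposite.op b) hy)
      simpa [mul_assoc] using h1
    | zero => simpa using zero_mem_annSeq _
    | add a b ha hb iha ihb =>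
      rw [mul_add]
      exact add_mem_annSeq
        (iha (TwoSidedIdeal.mem_span_iff_mem_addSubgroup_closure.2 ha))
        (ihb (TwoSidedIdeal.mem_span_iff_mem_addSubgroup_closure.2 hb))
    | neg a ha iha =>
      rw [mul_neg]
      exact neg_mem_annSeq (iha (TwoSidedIdeal.mem_span_iff_mem_addSubgroup_closure.2 ha))
  apply isLeftTNilpotent_of_one_mem
  by_contra h1
  obtain ⟨r, y, hy, hr⟩ := step 1 h1
  obtain ⟨y', -, h0⟩ := hJ.descent
    (fun z => ∃ y ∈ J, z * y ∉ annSeq (TwoSidedIdeal.span (J : Set R) : Set R)) (by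
      rintro z ⟨y, hy, hz⟩
      obtain ⟨r, y', hy', hz'⟩ := step _ hz
      exact ⟨y * r, J.smul_mem (MulOpposite.op r) hy, y', hy', by simpa [mul_assoc] using hz'⟩)
    (1 * r) ⟨y, hy, hr⟩
  exact h0 (by rw [zero_mul]; exact zero_mem_annSeq _)

variable (δ : RingDerivation R)

/-- The elements `a` of an ideal `K` with `δ a ∈ K`. -/
def deltaCore (K : TwoSidedIdeal R) : TwoSidedIdeal R :=
  TwoSidedIdeal.mk' {a | a ∈ K ∧ δ a ∈ K}
    ⟨K.zero_mem, by rw [map_zero]; exact K.zero_mem⟩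
    (fun ha hb => ⟨K.add_mem ha.1 hb.1, by rw [map_add]; exact K.add_mem ha.2 hb.2⟩)
    (fun ha => ⟨K.neg_mem ha.1, by rw [map_neg]; exact K.neg_mem ha.2⟩)
    (fun hb => ⟨K.mul_mem_left _ _ hb.1, by
      rw [δ.leibniz]
      exact K.add_mem (K.mul_mem_left _ _ hb.1) (K.mul_mem_left _ _ hb.2)⟩)
    (fun ha => ⟨K.mul_mem_right _ _ ha.1, by
      rw [δ.leibniz]
      exact K.add_mem (K.mul_mem_right _ _ ha.2) (K.mul_mem_right _ _ ha.1)⟩)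

theorem mem_deltaCore {K : TwoSidedIdeal R} {a : R} :
    a ∈ deltaCore δ K ↔ a ∈ K ∧ δ a ∈ K := by
  simp [deltaCore]

/-- The right ideal `∑_{j ≥ 0} δ^j(a) R`. -/
def deltaRightIdeal (a : R) : Submodule Rᵐᵒᵖ R :=
  Submodule.span Rᵐᵒᵖ (Set.range fun j : ℕ => δ^[j] a)

theorem isLeftTNilpotent_deltaRightIdeal_iff (a : R) :
    IsLeftTNilpotent (deltaRightIdeal δ a : Set R) ↔
      ∃ K : DeltaIdeal δ, IsLeftTNilpotent (K.ideal : Set R) ∧ a ∈ K.ideal := by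
  constructor
  · intro h
    refine ⟨⟨TwoSidedIdeal.span (deltaRightIdeal δ a : Set R), ?_⟩, h.span,
      TwoSidedIdeal.subset_span (Submodule.subset_span ⟨0, rfl⟩)⟩
    have hle : TwoSidedIdeal.span (deltaRightIdeal δ a : Set R) ≤
        deltaCore δ (TwoSidedIdeal.span (deltaRightIdeal δ a : Set R)) := by
      rw [TwoSidedIdeal.span_le]
      intro x hx
      refine (mem_deltaCore δ).2 ⟨TwoSidedIdeal.subset_span hx, ?_⟩
      refine TwoSidedIdeal.subset_span ?_
      induction hx using Submodule.span_induction with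
      | mem x hx =>
        obtain ⟨j, rfl⟩ := hx
        exact Submodule.subset_span ⟨j + 1, Function.iterate_succ_apply' _ _ _⟩
      | zero => rw [map_zero]; exact (deltaRightIdeal δ a).zero_mem
      | add x y _ _ hx hy => rw [map_add]; exact (deltaRightIdeal δ a).add_mem hx hy
      | smul r x hx hx' =>
        rw [MulOpposite.smul_eq_mul_unop, δ.leibniz]
        exact (deltaRightIdeal δ a).add_mem ((deltaRightIdeal δ a).smul_mem r hx')
          ((deltaRightIdeal δ a).smul_mem (MulOpposite.op (δ r.unop)) hx)
    exact fun x hx => ((mem_deltaCore δ).1 (hle hx)).2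
  · rintro ⟨K, hK, ha⟩
    refine hK.mono fun x hx => ?_
    have hj : ∀ j : ℕ, δ^[j] a ∈ K.ideal := by
      intro j
      induction j with
      | zero => exact ha
      | succ j ih => rw [Function.iterate_succ_apply']; exact K.map_mem _ ih
    induction hx using Submodule.span_induction with
    | mem x hx => obtain ⟨j, rfl⟩ := hx; exact hj j
    | zero => exact K.ideal.zero_mem
    | add x y _ _ hx hy => exact K.ideal.add_mem hx hy
    | smul r x _ hx => exact K.ideal.mul_mem_right _ _ hx

/-- The `δ`-ideal of all `a ∈ R` such that `∑_{j ≥ 0} δ^j(a) R` is left T-nilpotent. -/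
def deltaRadideal : DeltaIdeal δ where
  ideal := TwoSidedIdeal.mk' {a | IsLeftTNilpotent (deltaRightIdeal δ a : Set R)}
    ((isLeftTNilpotent_deltaRightIdeal_iff δ 0).2
      ⟨⟨⊥, fun a ha => by
        rw [TwoSidedIdeal.mem_bot] at ha ⊢
        rw [ha, map_zero]⟩,
      fun s hs => ⟨1, le_rfl, by simpa using TwoSidedIdeal.mem_bot R |>.1 (hs 0)⟩,
      TwoSidedIdeal.zero_mem _⟩)
    (fun {a b} ha hb => by
      obtain ⟨K, hK, haK⟩ := (isLeftTNilpotent_deltaRightIdeal_iff δ a).1 ha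
      obtain ⟨L, hL, hbL⟩ := (isLeftTNilpotent_deltaRightIdeal_iff δ b).1 hb
      refine (isLeftTNilpotent_deltaRightIdeal_iff δ _).2 ⟨⟨K.ideal ⊔ L.ideal, ?_⟩, hK.sup hL,
        TwoSidedIdeal.mem_sup.2 ⟨a, haK, b, hbL, rfl⟩⟩
      intro x hx
      obtain ⟨y, hy, z, hz, rfl⟩ := TwoSidedIdeal.mem_sup.1 hx
      rw [map_add]
      exact TwoSidedIdeal.mem_sup.2 ⟨_, K.map_mem _ hy, _, L.map_mem _ hz, rfl⟩)
    (fun {a} ha => by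
      obtain ⟨K, hK, haK⟩ := (isLeftTNilpotent_deltaRightIdeal_iff δ a).1 ha
      exact (isLeftTNilpotent_deltaRightIdeal_iff δ _).2 ⟨K, hK, K.ideal.neg_mem haK⟩)
    (fun {a b} hb => by
      obtain ⟨K, hK, hbK⟩ := (isLeftTNilpotent_deltaRightIdeal_iff δ b).1 hb
      exact (isLeftTNilpotent_deltaRightIdeal_iff δ _).2 ⟨K, hK, K.ideal.mul_mem_left _ _ hbK⟩)
    (fun {a b} ha => by
      obtain ⟨K, hK, haK⟩ := (isLeftTNilpotent_deltaRightIdeal_iff δ a).1 ha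
      exact (isLeftTNilpotent_deltaRightIdeal_iff δ _).2 ⟨K, hK, K.ideal.mul_mem_right _ _ haK⟩)
  map_mem a ha := by
    rw [TwoSidedIdeal.mem_mk'] at ha ⊢
    obtain ⟨K, hK, haK⟩ := (isLeftTNilpotent_deltaRightIdeal_iff δ a).1 ha
    exact (isLeftTNilpotent_deltaRightIdeal_iff δ _).2 ⟨K, hK, K.map_mem _ haK⟩

theorem mem_deltaRadideal {a : R} :
    a ∈ (deltaRadideal δ).ideal ↔ IsLeftTNilpotent (deltaRightIdeal δ a : Set R) := by
  simp [deltaRadideal]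

variable {δ}

/-- The derivation `a + J ↦ δ a + J` of `R / J` induced by `δ`, for a `δ`-ideal `J`. -/
def DeltaIdeal.quotientDerivation (J : DeltaIdeal δ) :
    RingDerivation J.ideal.ringCon.Quotient where
  toFun := Quotient.lift (fun a => J.ideal.ringCon.mk' (δ a)) fun a b h => by
    refine (RingCon.eq _).2 ?_
    rw [TwoSidedIdeal.rel_iff, ← map_sub]
    exact J.map_mem _ ((J.ideal.rel_iff a b).1 h)
  map_zero' := by
    show J.ideal.ringCon.mk' (δ 0) = 0
    rw [map_zero, map_zero]
  map_add' := by
    rintro ⟨a⟩ ⟨b⟩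
    show J.ideal.ringCon.mk' (δ (a + b)) = J.ideal.ringCon.mk' (δ a) + J.ideal.ringCon.mk' (δ b)
    rw [map_add, map_add]
  leibniz' := by
    rintro ⟨a⟩ ⟨b⟩
    show J.ideal.ringCon.mk' (δ (a * b)) = J.ideal.ringCon.mk' (δ a) * J.ideal.ringCon.mk' b +
      J.ideal.ringCon.mk' a * J.ideal.ringCon.mk' (δ b)
    rw [δ.leibniz, map_add, map_mul, map_mul]

theorem DeltaIdeal.quotientDerivation_mk (J : DeltaIdeal δ) (a : R) :
    J.quotientDerivation (J.ideal.ringCon.mk' a) = J.ideal.ringCon.mk' (δ a) := rfl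

/-- The preimage in `R` of a `δ̄`-ideal of `R / J`. -/
def DeltaIdeal.preimage (J : DeltaIdeal δ) (K : DeltaIdeal J.quotientDerivation) :
    DeltaIdeal δ where
  ideal := TwoSidedIdeal.comap J.ideal.ringCon.mk' K.ideal
  map_mem a ha := by
    rw [TwoSidedIdeal.mem_comap] at ha ⊢
    rw [← J.quotientDerivation_mk]
    exact K.map_mem _ ha

/-- The sum of a family of `δ`-ideals. -/
def DeltaIdeal.sum {ι : Sort*} (J : ι → DeltaIdeal δ) : DeltaIdeal δ where
  ideal := ⨆ i, (J i).ideal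
  map_mem := by
    have hle : (⨆ i, (J i).ideal) ≤ deltaCore δ (⨆ i, (J i).ideal) :=
      iSup_le fun i x hx => (mem_deltaCore δ).2
        ⟨le_iSup (fun i => (J i).ideal) i hx,
          le_iSup (fun i => (J i).ideal) i ((J i).map_mem x hx)⟩
    exact fun a ha => ((mem_deltaCore δ).1 (hle ha)).2

/-- The zero ideal as a `δ`-ideal. -/
def DeltaIdeal.zero (δ : RingDerivation R) : DeltaIdeal δ where
  ideal := ⊥
  map_mem a ha := by
    rw [TwoSidedIdeal.mem_bot] at ha ⊢
    rw [ha, map_zero]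

/-- The `δ`-analogues of the higher left T-nilpotent radideals, by transfinite recursion: `0` at
`0`; at `β + 1` the preimage in `R` of the ideal `deltaRadideal` of the quotient of `R` by the
`β`-th one, with the induced derivation; at a limit ordinal the sum of the earlier ones, which is
their union (`mem_deltaHigherRadideal_limit`). -/
noncomputable def deltaHigherRadideal (δ : RingDerivation R) (α : Ordinal.{v}) : DeltaIdeal δ :=
  Ordinal.limitRecOn α (DeltaIdeal.zero δ)
    (fun _ J => J.preimage (deltaRadideal J.quotientDerivation))
    (fun β _ ih => DeltaIdeal.sum fun γ : Set.Iio β => ih γ.1 γ.2)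

/-- `I((x⁻¹; δ))`: the series all of whose coefficients lie in `I`. -/
def PseudoDiffOp.coeffsIn (δ : RingDerivation R) (I : TwoSidedIdeal R) : Set (PseudoDiffOp δ) :=
  {f | ∀ i : ℤ, f.coeff i ∈ I}

end Radideal

section Union

variable {R : Type u} [Ring R]

theorem le_of_transfinite (f : Ordinal.{v} → TwoSidedIdeal R)
    (hs : ∀ β, f β ≤ f (β + 1))
    (hl : ∀ β, Order.IsSuccLimit β → ∀ γ < β, f γ ≤ f β) (β : Ordinal.{v}) :
    ∀ γ ≤ β, f γ ≤ f β := by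
  induction β using Ordinal.limitRecOn with
  | zero => intro γ hγ; rw [le_antisymm hγ zero_le]
  | add_one β ih =>
    intro γ hγ
    rcases hγ.lt_or_eq with h | h
    · exact (ih γ (Order.lt_add_one_iff.1 h)).trans (hs β)
    · rw [h]
  | limit β hβ ih =>
    intro γ hγ
    rcases hγ.lt_or_eq with h | h
    · exact hl β hβ γ h
    · rw [h]

theorem mem_iSup_of_chain {ι : Type*} [LinearOrder ι] [Nonempty ι] (f : ι → TwoSidedIdeal R)
    (hf : Monotone f) (x : R) : x ∈ ⨆ i, f i ↔ ∃ i, x ∈ f i := by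
  constructor
  · intro hx
    let U : TwoSidedIdeal R := TwoSidedIdeal.mk' {a | ∃ i, a ∈ f i}
      ⟨Classical.arbitrary ι, TwoSidedIdeal.zero_mem _⟩
      (by
        rintro a b ⟨i, hi⟩ ⟨j, hj⟩
        exact ⟨max i j, TwoSidedIdeal.add_mem _ (hf (le_max_left i j) hi)
          (hf (le_max_right i j) hj)⟩)
      (by rintro a ⟨i, hi⟩; exact ⟨i, TwoSidedIdeal.neg_mem _ hi⟩)
      (by rintro a b ⟨i, hi⟩; exact ⟨i, TwoSidedIdeal.mul_mem_left _ _ _ hi⟩)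
      (by rintro a b ⟨i, hi⟩; exact ⟨i, TwoSidedIdeal.mul_mem_right _ _ _ hi⟩)
    have hmem : ∀ a, a ∈ U ↔ ∃ i, a ∈ f i := fun a => by simp [U]
    have hU : ⨆ i, f i ≤ U := iSup_le fun i a ha => (hmem a).2 ⟨i, ha⟩
    exact (hmem x).1 (hU hx)
  · rintro ⟨i, hi⟩
    exact le_iSup f i hi

theorem higherRadideal_zero : higherRadideal R (0 : Ordinal.{v}) = ⊥ :=
  Ordinal.limitRecOn_zero ..

theorem mem_higherRadideal_add_one (β : Ordinal.{v}) (a : R) :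
    a ∈ higherRadideal R (β + 1) ↔ (higherRadideal R β).ringCon.mk' a ∈
      leftTNilRadideal (higherRadideal R β).ringCon.Quotient := by
  rw [higherRadideal, Ordinal.limitRecOn_add_one]
  exact TwoSidedIdeal.mem_comap _

theorem higherRadideal_limit {β : Ordinal.{v}} (hβ : Order.IsSuccLimit β) :
    higherRadideal R β = ⨆ γ : Set.Iio β, higherRadideal R γ.1 := by
  rw [higherRadideal, Ordinal.limitRecOn_limit _ _ _ _ hβ, iSup_subtype']
  rfl

theorem mk_mem_of_mem (I : TwoSidedIdeal R) (K : TwoSidedIdeal I.ringCon.Quotient) {a : R}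
    (ha : a ∈ I) : I.ringCon.mk' a ∈ K := by
  have h0 : I.ringCon.mk' a = 0 := (RingCon.eq _).2 ((I.mem_iff a).1 ha)
  rw [h0]
  exact K.zero_mem

theorem higherRadideal_mono {β γ : Ordinal.{v}} (h : γ ≤ β) :
    higherRadideal R γ ≤ higherRadideal R β := by
  refine le_of_transfinite (higherRadideal R) (fun β a ha => ?_) (fun β hβ γ hγ => ?_) β γ h
  · exact (mem_higherRadideal_add_one β a).2 (mk_mem_of_mem _ _ ha)
  · rw [higherRadideal_limit hβ]
    exact le_iSup (fun γ : Set.Iio β => higherRadideal R γ.1) ⟨γ, hγ⟩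

theorem mem_higherRadideal_limit {β : Ordinal.{v}} (hβ : Order.IsSuccLimit β) (a : R) :
    a ∈ higherRadideal R β ↔ ∃ γ < β, a ∈ higherRadideal R γ := by
  have : Nonempty (Set.Iio β) := ⟨⟨0, hβ.bot_lt⟩⟩
  rw [higherRadideal_limit hβ, mem_iSup_of_chain (fun γ : Set.Iio β => higherRadideal R γ.1)
    fun _ _ h => higherRadideal_mono h]
  simp

variable (δ : RingDerivation R)

theorem deltaHigherRadideal_zero : (deltaHigherRadideal δ (0 : Ordinal.{v})).ideal = ⊥ := by
  rw [deltaHigherRadideal, Ordinal.limitRecOn_zero]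
  rfl

theorem mem_deltaHigherRadideal_add_one (β : Ordinal.{v}) (a : R) :
    a ∈ (deltaHigherRadideal δ (β + 1)).ideal ↔
      (deltaHigherRadideal δ β).ideal.ringCon.mk' a ∈
        (deltaRadideal (deltaHigherRadideal δ β).quotientDerivation).ideal := by
  rw [deltaHigherRadideal, Ordinal.limitRecOn_add_one]
  exact TwoSidedIdeal.mem_comap _

theorem deltaHigherRadideal_limit {β : Ordinal.{v}} (hβ : Order.IsSuccLimit β) :
    (deltaHigherRadideal δ β).ideal = ⨆ γ : Set.Iio β, (deltaHigherRadideal δ γ.1).ideal := by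
  rw [deltaHigherRadideal, Ordinal.limitRecOn_limit _ _ _ _ hβ]
  rfl

theorem deltaHigherRadideal_mono {β γ : Ordinal.{v}} (h : γ ≤ β) :
    (deltaHigherRadideal δ γ).ideal ≤ (deltaHigherRadideal δ β).ideal := by
  refine le_of_transfinite (fun β => (deltaHigherRadideal δ β).ideal) (fun β a ha => ?_)
    (fun β hβ γ hγ => ?_) β γ h
  · exact (mem_deltaHigherRadideal_add_one δ β a).2 (mk_mem_of_mem _ _ ha)
  · show (deltaHigherRadideal δ γ).ideal ≤ (deltaHigherRadideal δ β).ideal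
    rw [deltaHigherRadideal_limit δ hβ]
    exact le_iSup (fun γ : Set.Iio β => (deltaHigherRadideal δ γ.1).ideal) ⟨γ, hγ⟩

theorem mem_deltaHigherRadideal_limit {β : Ordinal.{v}} (hβ : Order.IsSuccLimit β) (a : R) :
    a ∈ (deltaHigherRadideal δ β).ideal ↔ ∃ γ < β, a ∈ (deltaHigherRadideal δ γ).ideal := by
  have : Nonempty (Set.Iio β) := ⟨⟨0, hβ.bot_lt⟩⟩
  rw [deltaHigherRadideal_limit δ hβ,
    mem_iSup_of_chain (fun γ : Set.Iio β => (deltaHigherRadideal δ γ.1).ideal)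
      fun _ _ h => deltaHigherRadideal_mono δ h]
  simp

end Union

/-! ### Nilpotent ideals and Levitzki's theorem -/

section Nilpotent

variable {R : Type u} [Ring R]

/-! The heart is the case α = 1. Let N be the δ-radideal of R. Its elements are nilpotent, so
Levitzki's theorem (`TwoSidedIdeal.isNilpotentIdeal_of_nil`) makes N nilpotent. Coefficients of a
product are integer combinations of terms f_i δ^k(g_j), so N((x⁻¹; δ)) is nilpotent too
(`isNilpotentIdeal_coeffsIdeal`) and lies in the left T-nilpotent radideal.

Conversely, let I be a left T-nilpotent ideal of the series ring. Enlarging it by N((x⁻¹; δ)) keeps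
it left T-nilpotent. Its leading coefficients form a δ-ideal of R, because δ acts on coefficients as
the commutator with x, and this ideal is left T-nilpotent, because leading coefficients in degree 0
multiply. So they lie in N, and leading terms can be subtracted one after another without leaving
the enlarged ideal (`coeff_mem_of_leadingIdeal_le`); hence every coefficient lies in N.

Successor ordinals reduce to this case over R/J, which is again Noetherian, since R((x⁻¹; δ)) modulo
J((x⁻¹; δ)) is (R/J)((x⁻¹; δ̄)). At a limit ordinal the coefficients of one series might need
infinitely many earlier stages; the ascending chain condition on ideals of R supplies a single
stage. -/

/-- The elements `x` such that `x * s₁ * ⋯ * sₖ = 0` for all `s₁, …, sₖ` in the ideal `I`. -/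
def leftAnnPow (I : TwoSidedIdeal R) : ℕ → AddSubgroup R
  | 0 => ⊥
  | k + 1 =>
    { carrier := {x | ∀ s ∈ I, x * s ∈ leftAnnPow I k}
      zero_mem' := fun s _ => by rw [zero_mul]; exact zero_mem _
      add_mem' := fun hx hy s hs => by rw [add_mul]; exact add_mem (hx s hs) (hy s hs)
      neg_mem' := fun hx s hs => by rw [neg_mul]; exact neg_mem (hx s hs) }

theorem mem_leftAnnPow_zero {I : TwoSidedIdeal R} {x : R} : x ∈ leftAnnPow I 0 ↔ x = 0 :=
  AddSubgroup.mem_bot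

theorem mem_leftAnnPow_succ {I : TwoSidedIdeal R} {k : ℕ} {x : R} :
    x ∈ leftAnnPow I (k + 1) ↔ ∀ s ∈ I, x * s ∈ leftAnnPow I k := Iff.rfl

/-- The ideal `I` is nilpotent: `I ^ k = 0` for some `k`. -/
def TwoSidedIdeal.IsNilpotentIdeal (I : TwoSidedIdeal R) : Prop := ∃ k, 1 ∈ leftAnnPow I k

theorem TwoSidedIdeal.isNilpotentIdeal_bot : (⊥ : TwoSidedIdeal R).IsNilpotentIdeal := by
  refine ⟨0 + 1, mem_leftAnnPow_succ.2 fun s hs => ?_⟩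
  rw [(TwoSidedIdeal.mem_bot R).1 hs, mul_zero]
  exact AddSubgroup.zero_mem _

/-- Two consecutive factors from `Q` merge into one factor from `P`, so doubling the exponent
suffices. -/
theorem TwoSidedIdeal.IsNilpotentIdeal.of_mul_mem {P Q : TwoSidedIdeal R}
    (hP : P.IsNilpotentIdeal) (h : ∀ x ∈ Q, ∀ y ∈ Q, x * y ∈ P) : Q.IsNilpotentIdeal := by
  have key : ∀ k, leftAnnPow P k ≤ leftAnnPow Q (2 * k) := by
    intro k
    induction k with
    | zero => exact le_rfl
    | succ k ih =>
      intro x hx s hs t ht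
      rw [mul_assoc]
      exact ih (hx _ (h s hs t ht))
  obtain ⟨k, hk⟩ := hP
  exact ⟨2 * k, key k hk⟩

theorem leftAnnPow_mul_prod {I : TwoSidedIdeal R} (s : ℕ → R) (hs : ∀ i, s i ∈ I) (j k : ℕ)
    (x : R) (hx : x ∈ leftAnnPow I (j + k)) :
    x * ((List.range k).map s).prod ∈ leftAnnPow I j := by
  induction k generalizing j with
  | zero => simpa using hx
  | succ k ih =>
    rw [List.range_succ, List.map_append, List.prod_append, ← mul_assoc]
    -- The product grows on the right, so the first `k` factors must leave one factor in reserve for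
    -- `s k`.
    have := ih (j + 1) (by rwa [add_right_comm])
    simpa using this (s k) (hs k)

theorem TwoSidedIdeal.IsNilpotentIdeal.isLeftTNilpotent {I : TwoSidedIdeal R}
    (hI : I.IsNilpotentIdeal) : IsLeftTNilpotent (I : Set R) := by
  obtain ⟨k, hk⟩ := hI
  refine isLeftTNilpotent_of_one_mem fun s hs => ⟨k, ?_⟩
  exact mem_leftAnnPow_zero.1 (leftAnnPow_mul_prod s hs 0 k 1 (by rwa [zero_add]))

theorem IsLeftTNilpotent.isNilpotent {S : Set R} (hS : IsLeftTNilpotent S) {x : R} (hx : x ∈ S) :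
    IsNilpotent x := by
  obtain ⟨k, -, hk⟩ := hS (fun _ => x) fun _ => hx
  exact ⟨k, by simpa using hk⟩

/-- Take `a` in `N` outside `P` whose left annihilator modulo `P` is maximal. If (ar)^(n+2) is the
least power in `P`, then (ar)^(n+1) is a competitor with at least as large an annihilator, hence the
same one. It is annihilated by ar modulo `P`, so `a` is as well. -/
theorem TwoSidedIdeal.exists_mul_mul_mem_of_nil_left [IsNoetherianRing R] {P N : TwoSidedIdeal R}
    (hN : ∀ x ∈ N, IsNilpotent x) (hNP : ¬ N ≤ P) :
    ∃ a ∈ N, a ∉ P ∧ ∀ r, a * r * a ∈ P := by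
  let ann : R → Ideal R := fun a => Submodule.comap (LinearMap.toSpanSingleton R R a) P.asIdeal
  have mem_ann : ∀ a x, x ∈ ann a ↔ x * a ∈ P := fun a x => by
    simp [ann, TwoSidedIdeal.mem_asIdeal]
  obtain ⟨b, hbN, hbP⟩ : ∃ b ∈ N, b ∉ P := by
    by_contra! hc
    exact hNP fun x hx => hc x hx
  obtain ⟨_, ⟨a, ⟨haN, haP⟩, rfl⟩, hmax⟩ := set_has_maximal_iff_noetherian.2
    (inferInstance : IsNoetherian R R) (ann '' {a | a ∈ N ∧ a ∉ P}) ⟨_, b, ⟨hbN, hbP⟩, rfl⟩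
  refine ⟨a, haN, haP, fun r => ?_⟩
  classical
  have hex : ∃ n, (a * r) ^ n ∈ P := by
    obtain ⟨n, hn⟩ := hN (a * r) (N.mul_mem_right _ _ haN)
    exact ⟨n, by rw [hn]; exact P.zero_mem⟩
  obtain ⟨n, hn, hmin⟩ : ∃ n, (a * r) ^ n ∈ P ∧ ∀ m < n, (a * r) ^ m ∉ P :=
    ⟨Nat.find hex, Nat.find_spec hex, fun m hm => Nat.find_min hex hm⟩
  -- Exponents 0 and 1 are separate: the preceding power must be a right multiple of `a` to lie in
  -- `N` and be compared with `a`.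
  match n, hn, hmin with
  | 0, hn, _ =>
    refine absurd ?_ haP
    simpa using P.mul_mem_left a _ hn
  | 1, hn, _ =>
    rw [pow_one] at hn
    exact P.mul_mem_right _ _ hn
  | n + 2, hn, hmin =>
    have hle : ann a ≤ ann ((a * r) ^ (n + 1)) := by
      intro x hx
      rw [mem_ann] at hx ⊢
      rw [pow_succ', ← mul_assoc, ← mul_assoc]
      exact P.mul_mem_right _ _ (P.mul_mem_right _ _ hx)
    have heq : ann a = ann ((a * r) ^ (n + 1)) := by
      refine hle.eq_of_not_lt (hmax _ ⟨_, ⟨?_, hmin _ (by omega)⟩, rfl⟩)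
      rw [pow_succ', mul_assoc]
      exact N.mul_mem_right _ _ haN
    rw [← mem_ann, heq, mem_ann, ← pow_succ']
    exact hn

/-- The condition `a * r * a ∈ P` is unchanged when multiplication is reversed, so the right
Noetherian case is the left one in the opposite ring. -/
theorem TwoSidedIdeal.exists_mul_mul_mem_of_nil
    (hR : IsNoetherianRing R ∨ IsNoetherianRing Rᵐᵒᵖ) {P N : TwoSidedIdeal R}
    (hN : ∀ x ∈ N, IsNilpotent x) (hNP : ¬ N ≤ P) :
    ∃ a ∈ N, a ∉ P ∧ ∀ r, a * r * a ∈ P := by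
  rcases hR with hR | hR
  · exact exists_mul_mul_mem_of_nil_left hN hNP
  · obtain ⟨a, haN, haP, ha⟩ := exists_mul_mul_mem_of_nil_left (P := P.op) (N := N.op)
      (fun x hx => by
        obtain ⟨n, hn⟩ := hN _ (TwoSidedIdeal.mem_op_iff.1 hx)
        exact ⟨n, MulOpposite.unop_injective (by simpa using hn)⟩)
      (fun h => hNP fun x hx => by
        simpa [TwoSidedIdeal.mem_op_iff] using
          h (show MulOpposite.op x ∈ N.op by simpa [TwoSidedIdeal.mem_op_iff] using hx))
    refine ⟨a.unop, TwoSidedIdeal.mem_op_iff.1 haN, fun h => haP (TwoSidedIdeal.mem_op_iff.2 h),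
      fun r => ?_⟩
    have := TwoSidedIdeal.mem_op_iff.1 (ha (MulOpposite.op r))
    simpa [mul_assoc] using this

theorem TwoSidedIdeal.wellFoundedGT_of_noetherian
    (hR : IsNoetherianRing R ∨ IsNoetherianRing Rᵐᵒᵖ) : WellFoundedGT (TwoSidedIdeal R) := by
  rcases hR with hR | hR
  · have hm : StrictMono (TwoSidedIdeal.asIdeal (R := R)) :=
      (OrderHom.monotone _).strictMono_of_injective fun I J h => TwoSidedIdeal.ext fun x => by
        rw [← TwoSidedIdeal.mem_asIdeal, h, TwoSidedIdeal.mem_asIdeal]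
    exact hm.wellFoundedGT
  · have hm : StrictMono (TwoSidedIdeal.asIdealOpposite (R := R)) :=
      (OrderHom.monotone _).strictMono_of_injective fun I J h => TwoSidedIdeal.ext fun x => by
        have := congrArg (MulOpposite.op x ∈ ·) h
        simpa [TwoSidedIdeal.mem_asIdealOpposite] using this
    exact hm.wellFoundedGT

/-- Levitzki's theorem: a nil ideal of a left or right Noetherian ring is nilpotent. -/
theorem TwoSidedIdeal.isNilpotentIdeal_of_nil
    (hR : IsNoetherianRing R ∨ IsNoetherianRing Rᵐᵒᵖ) {N : TwoSidedIdeal R}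
    (hN : ∀ x ∈ N, IsNilpotent x) : N.IsNilpotentIdeal := by
  have := wellFoundedGT_of_noetherian hR
  -- `P` is maximal among the nilpotent ideals. If `N` were not inside it, adjoining a suitable `a`
  -- would give a larger ideal whose square lies in `P`, hence a larger nilpotent ideal.
  obtain ⟨P, hP, hmax⟩ := wellFounded_gt.has_min {P : TwoSidedIdeal R | P.IsNilpotentIdeal}
    ⟨⊥, isNilpotentIdeal_bot⟩
  by_cases hNP : N ≤ P
  · exact hP.of_mul_mem fun x hx y _ => P.mul_mem_right _ _ (hNP hx)
  obtain ⟨a, -, haP, ha⟩ := exists_mul_mul_mem_of_nil hR hN hNP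
  have hlt : P < P ⊔ TwoSidedIdeal.span {a} :=
    lt_of_le_not_ge le_sup_left fun h => haP <| h <|
      (le_sup_right : TwoSidedIdeal.span {a} ≤ P ⊔ TwoSidedIdeal.span {a})
        (TwoSidedIdeal.subset_span rfl)
  refine absurd hlt (hmax (P ⊔ TwoSidedIdeal.span {a}) (hP.of_mul_mem ?_))
  -- The relation aRa ⊆ P is extended to the generated ideal one factor at a time, with `r` left
  -- free to absorb the ring elements between the factors.
  · have haa : ∀ x ∈ TwoSidedIdeal.span {a}, ∀ r, x * r * a ∈ P := by
      intro x hx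
      rw [TwoSidedIdeal.mem_span_iff_mem_addSubgroup_closure] at hx
      induction hx using AddSubgroup.closure_induction with
      | mem z hz =>
        obtain ⟨w, ⟨b, -, y, rfl, rfl⟩, c, -, rfl⟩ := hz
        intro r
        have := P.mul_mem_left b _ (ha (c * r))
        simpa [mul_assoc] using this
      | zero => intro r; simp
      | add x y _ _ hx hy => intro r; simpa [add_mul] using P.add_mem (hx r) (hy r)
      | neg x _ hx => intro r; simpa using P.neg_mem (hx r)
    have hss : ∀ x ∈ TwoSidedIdeal.span {a}, ∀ y ∈ TwoSidedIdeal.span {a}, x * y ∈ P := by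
      intro x hx y hy
      rw [TwoSidedIdeal.mem_span_iff_mem_addSubgroup_closure] at hy
      induction hy using AddSubgroup.closure_induction with
      | mem z hz =>
        obtain ⟨w, ⟨b, -, y, rfl, rfl⟩, c, -, rfl⟩ := hz
        have := P.mul_mem_right _ c (haa x hx b)
        simpa [mul_assoc] using this
      | zero => simp
      | add y z _ _ hy hz => simpa [mul_add] using P.add_mem hy hz
      | neg y _ hy => simpa using P.neg_mem hy
    intro x hx y hy
    obtain ⟨p, hp, s, hs, rfl⟩ := TwoSidedIdeal.mem_sup.1 hx
    obtain ⟨q, hq, t, ht, rfl⟩ := TwoSidedIdeal.mem_sup.1 hy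
    rw [add_mul]
    exact P.add_mem (P.mul_mem_right _ _ hp)
      (by rw [mul_add]; exact P.add_mem (P.mul_mem_left _ _ hq) (hss s hs t ht))

end Nilpotent

/-! ### Invariance of the radideal under isomorphism -/

section Transport

variable {R : Type u} [Ring R] {S : Type v} [Ring S]

theorem leftTNilRadideal_le_comap (e : R ≃+* S) :
    leftTNilRadideal R ≤ TwoSidedIdeal.comap (e : R →+* S) (leftTNilRadideal S) := by
  refine sSup_le fun K hK x hx => ?_
  rw [TwoSidedIdeal.mem_comap]
  refine le_sSup (a := TwoSidedIdeal.comap (e.symm : S →+* R) K) ?_ ?_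
  · intro s hs
    obtain ⟨k, hk, h0⟩ := hK (fun i => e.symm (s i)) fun i => by
      simpa [TwoSidedIdeal.mem_comap] using hs i
    refine ⟨k, hk, e.symm.injective ?_⟩
    rw [map_zero, ← h0, map_list_prod, List.map_map]
    rfl
  · rw [TwoSidedIdeal.mem_comap]
    simpa using hx

theorem mem_leftTNilRadideal_equiv (e : R ≃+* S) {x : R} :
    e x ∈ leftTNilRadideal S ↔ x ∈ leftTNilRadideal R := by
  constructor
  · intro h
    simpa [TwoSidedIdeal.mem_comap] using leftTNilRadideal_le_comap e.symm h
  · intro h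
    simpa [TwoSidedIdeal.mem_comap] using leftTNilRadideal_le_comap e h

/-- The first isomorphism theorem identifies the quotient with `S`. The kernel is given pointwise,
the form in which the inductive hypothesis describes a higher radideal. -/
theorem mk_mem_leftTNilRadideal_iff (I : TwoSidedIdeal R) (f : R →+* S)
    (hf : Function.Surjective f) (hI : ∀ x, f x = 0 ↔ x ∈ I) (x : R) :
    I.ringCon.mk' x ∈ leftTNilRadideal I.ringCon.Quotient ↔ f x ∈ leftTNilRadideal S := by
  have hker : ∀ x y, I.ringCon x y ↔ f x = f y := fun x y => by
    rw [TwoSidedIdeal.rel_iff, ← hI, map_sub, sub_eq_zero]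
  let g : I.ringCon.Quotient →+* S := I.ringCon.lift f fun {x y} h => (hker x y).1 h
  have hg : Function.Bijective g := by
    constructor
    · rintro ⟨x⟩ ⟨y⟩ h
      exact (RingCon.eq _).2 ((hker x y).2 h)
    · intro y
      obtain ⟨x, rfl⟩ := hf y
      exact ⟨I.ringCon.mk' x, rfl⟩
  exact (mem_leftTNilRadideal_equiv (RingEquiv.ofBijective g hg)).symm

end Transport

/-! ### Products with monomials and top coefficients -/

namespace PseudoDiffOp

variable {R : Type u} [Ring R] {δ : RingDerivation R}

/-- The series `a x^n`. -/
def monomial (δ : RingDerivation R) (n : ℤ) (a : R) : PseudoDiffOp δ where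
  coeff i := if i = n then a else 0
  bdd := ⟨n, fun i hi => if_neg (by omega)⟩

theorem coeff_monomial (n : ℤ) (a : R) (i : ℤ) :
    (monomial δ n a).coeff i = if i = n then a else 0 := rfl

theorem coeff_sub (f g : PseudoDiffOp δ) (i : ℤ) : (f - g).coeff i = f.coeff i - g.coeff i := by
  rw [sub_eq_add_neg, coeff_add, coeff_neg, sub_eq_add_neg]

/-- Since δ(1) = 0, a power of x on the right produces no correction terms. Degrees can thus be
normalised without altering coefficients. -/
theorem coeff_mul_monomial_one (f : PseudoDiffOp δ) (n m : ℤ) :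
    (f * monomial δ n 1).coeff m = f.coeff (m - n) := by
  rw [coeff_mul, finsum_eq_single _ (m - n, 0)]
  · simp [mulTerm, coeff_monomial]
  · rintro ⟨i, k⟩ h
    by_cases hi : m - i + k = n
    · have hk : k ≠ 0 := fun hk => h (by subst hk; simp; omega)
      obtain ⟨k, rfl⟩ := Nat.exists_eq_succ_of_ne_zero hk
      simp only [mulTerm, coeff_monomial, hi, if_true, Function.iterate_succ_apply, δ.map_one,
        δ.iterate_map_zero, mul_zero, smul_zero]
    · simp only [mulTerm, coeff_monomial, hi, if_false, δ.iterate_map_zero, mul_zero, smul_zero]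

theorem coeff_monomial_zero_mul (a : R) (f : PseudoDiffOp δ) (m : ℤ) :
    (monomial δ 0 a * f).coeff m = a * f.coeff m := by
  rw [coeff_mul, finsum_eq_single _ (0, 0)]
  · simp [mulTerm, coeff_monomial]
  · rintro ⟨i, k⟩ h
    by_cases hi : i = 0
    · subst hi
      have hk : 0 < k := Nat.pos_of_ne_zero fun hk => h (by rw [hk])
      simp only [mulTerm]
      rw [Ring.choose_zero_pos ℤ hk, zero_smul]
    · simp [mulTerm, coeff_monomial, hi]

/-- Binomials (1 choose k) vanish for k ≥ 2. Comparison with the pure shift on the right exhibits δ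
as the commutator with x. -/
theorem coeff_monomial_one_one_mul (f : PseudoDiffOp δ) (m : ℤ) :
    (monomial δ 1 1 * f).coeff m = f.coeff (m - 1) + δ (f.coeff m) := by
  rw [coeff_mul, finsum_eq_sum_of_support_subset (s := {(1, 0), (1, 1)})]
  · rw [Finset.sum_pair (by simp)]
    simp [mulTerm, coeff_monomial]
  · rintro ⟨i, k⟩ h
    rw [Function.mem_support] at h
    have hi : i = 1 := by
      by_contra hi
      exact h (by simp [mulTerm, coeff_monomial, hi])
    subst hi
    have hk : k < 2 := by
      by_contra! hk
      refine h ?_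
      have h1 : Ring.choose (1 : ℤ) k = 0 := by
        have := Ring.choose_natCast (R := ℤ) 1 k
        rw [Nat.choose_eq_zero_of_lt (by omega)] at this
        simpa using this
      simp only [mulTerm, h1, zero_smul]
    interval_cases k <;> simp

theorem mulTerm_eq_zero {f g : PseudoDiffOp δ} (hf : ∀ i, 0 < i → f.coeff i = 0)
    (hg : ∀ i, 0 < i → g.coeff i = 0) {m : ℤ} {p : ℤ × ℕ} (h : 0 < p.1 ∨ 0 < m - p.1 + p.2) :
    mulTerm δ f.coeff g.coeff m p = 0 := by
  rcases h with h | h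
  · simp [mulTerm, hf _ h]
  · simp [mulTerm, hg _ h, δ.iterate_map_zero]

theorem coeff_mul_of_pos {f g : PseudoDiffOp δ} (hf : ∀ i, 0 < i → f.coeff i = 0)
    (hg : ∀ i, 0 < i → g.coeff i = 0) (m : ℤ) (hm : 0 < m) : (f * g).coeff m = 0 := by
  rw [coeff_mul, ← finsum_zero (α := ℤ × ℕ) (M := R)]
  exact finsum_congr fun p => mulTerm_eq_zero hf hg (by omega)

/-- A surviving term needs i ≤ 0 and k ≤ i, so i = k = 0: derivatives only affect lower degrees. -/
theorem coeff_mul_zero {f g : PseudoDiffOp δ} (hf : ∀ i, 0 < i → f.coeff i = 0)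
    (hg : ∀ i, 0 < i → g.coeff i = 0) : (f * g).coeff 0 = f.coeff 0 * g.coeff 0 := by
  rw [coeff_mul, finsum_eq_single _ (0, 0)]
  · simp [mulTerm]
  · rintro ⟨i, k⟩ h
    refine mulTerm_eq_zero hf hg ?_
    by_contra! hc
    simp only at hc
    exact h (Prod.ext (by simp only; omega) (by simp only; omega))

theorem coeff_prod_zero (f : ℕ → PseudoDiffOp δ) (hf : ∀ n, ∀ i, 0 < i → (f n).coeff i = 0)
    (k : ℕ) : (∀ i, 0 < i → (((List.range k).map f).prod).coeff i = 0) ∧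
      (((List.range k).map f).prod).coeff 0 = ((List.range k).map fun n => (f n).coeff 0).prod := by
  induction k with
  | zero =>
    refine ⟨fun i hi => ?_, ?_⟩
    · simp [coeff_one, hi.ne']
    · simp [coeff_one]
  | succ k ih =>
    simp only [List.range_succ, List.map_append, List.prod_append, List.map_cons, List.map_nil,
      List.prod_cons, List.prod_nil, mul_one]
    exact ⟨coeff_mul_of_pos ih.1 (hf k), by rw [coeff_mul_zero ih.1 (hf k), ih.2]⟩

/-! ### Change of coefficients and reduction modulo a δ-ideal -/

/-- The ring homomorphism applying `φ : R → R'` to all coefficients, where `φ ∘ δ = δ' ∘ φ`. -/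
noncomputable def map {R' : Type v} [Ring R'] {δ' : RingDerivation R'} (φ : R →+* R')
    (h : ∀ a, φ (δ a) = δ' (φ a)) : PseudoDiffOp δ →+* PseudoDiffOp δ' where
  toFun f := ⟨fun i => φ (f.coeff i), by
    obtain ⟨n, hn⟩ := f.bdd
    exact ⟨n, fun i hi => by rw [hn i hi, map_zero]⟩⟩
  map_one' := by
    ext i
    simp only [coeff_one]
    split_ifs <;> simp
  map_zero' := by
    ext i
    exact map_zero φ
  map_add' f g := by
    ext i
    exact map_add φ _ _
  map_mul' f g := by
    ext m
    simp only [coeff_mul]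
    have hiter : ∀ (k : ℕ) (a : R), φ (δ^[k] a) = δ'^[k] (φ a) := fun k a =>
      (Function.Semiconj.iterate_right (f := φ) h k) a
    rw [map_finsum φ (mulTerm_finite f.bdd g.bdd m)]
    refine finsum_congr fun p => ?_
    simp only [mulTerm, map_zsmul, map_mul, hiter]

theorem coeff_map {R' : Type v} [Ring R'] {δ' : RingDerivation R'} (φ : R →+* R')
    (h : ∀ a, φ (δ a) = δ' (φ a)) (f : PseudoDiffOp δ) (i : ℤ) :
    (map φ h f).coeff i = φ (f.coeff i) := rfl

theorem map_surjective {R' : Type v} [Ring R'] {δ' : RingDerivation R'} (φ : R →+* R')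
    (h : ∀ a, φ (δ a) = δ' (φ a)) (hφ : Function.Surjective φ) : Function.Surjective (map φ h) := by
  intro g
  obtain ⟨n, hn⟩ := g.bdd
  choose t ht using hφ
  -- The chosen section `t` need not send 0 to 0, so the lift is cut off above the degree bound.
  refine ⟨⟨fun i => if n < i then 0 else t (g.coeff i), n, fun i hi => if_pos hi⟩, ?_⟩
  ext i
  rw [coeff_map]
  dsimp only
  split_ifs with hi
  · rw [map_zero, hn i hi]
  · exact ht _

/-- The homomorphism `R((x⁻¹; δ)) → (R / J)((x⁻¹; δ̄))` for a `δ`-ideal `J`. -/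
noncomputable def mapQuotient (J : DeltaIdeal δ) :
    PseudoDiffOp δ →+* PseudoDiffOp J.quotientDerivation :=
  map J.ideal.ringCon.mk' fun a => (J.quotientDerivation_mk a).symm

theorem mapQuotient_surjective (J : DeltaIdeal δ) : Function.Surjective (mapQuotient J) :=
  map_surjective _ _ (RingCon.mk'_surjective _)

theorem mapQuotient_eq_zero_iff (J : DeltaIdeal δ) (f : PseudoDiffOp δ) :
    mapQuotient J f = 0 ↔ ∀ i, f.coeff i ∈ J.ideal := by
  have key : ∀ a, J.ideal.ringCon.mk' a = 0 ↔ a ∈ J.ideal := fun a => by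
    rw [← TwoSidedIdeal.mem_ker, TwoSidedIdeal.ker_ringCon_mk']
  constructor
  · intro h i
    rw [← key, ← coeff_map (δ := δ) _ fun a => (J.quotientDerivation_mk a).symm]
    exact congrArg (fun g => coeff g i) h
  · intro h
    ext i
    exact (key _).2 (h i)

/-- `J((x⁻¹; δ))` as a two-sided ideal, for a `δ`-ideal `J`. -/
noncomputable def coeffsIdeal (J : DeltaIdeal δ) : TwoSidedIdeal (PseudoDiffOp δ) :=
  TwoSidedIdeal.ker (mapQuotient J)

theorem mem_coeffsIdeal {J : DeltaIdeal δ} {f : PseudoDiffOp δ} :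
    f ∈ coeffsIdeal J ↔ ∀ i, f.coeff i ∈ J.ideal := by
  rw [coeffsIdeal, TwoSidedIdeal.mem_ker, mapQuotient_eq_zero_iff]

end PseudoDiffOp

/-! ### Nilpotency and leading coefficients of ideals of series -/

theorem DeltaIdeal.iterate_mem {R : Type u} [Ring R] {δ : RingDerivation R} (J : DeltaIdeal δ)
    {a : R} (ha : a ∈ J.ideal) (k : ℕ) : δ^[k] a ∈ J.ideal := by
  induction k with
  | zero => exact ha
  | succ k ih => rw [Function.iterate_succ_apply']; exact J.map_mem _ ih

namespace PseudoDiffOp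

variable {R : Type u} [Ring R] {δ : RingDerivation R}

/-- Each δ^k(g_j) stays in `J`, so multiplying by a series over `J` uses up one factor from `J` in
every coefficient. Starting from the series 1 gives the same exponent as for `J`. -/
theorem isNilpotentIdeal_coeffsIdeal {J : DeltaIdeal δ} (hJ : J.ideal.IsNilpotentIdeal) :
    (coeffsIdeal J).IsNilpotentIdeal := by
  have key : ∀ k (f : PseudoDiffOp δ), (∀ i, f.coeff i ∈ leftAnnPow J.ideal k) →
      f ∈ leftAnnPow (coeffsIdeal J) k := by
    intro k
    induction k with
    | zero =>
      intro f hf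
      rw [mem_leftAnnPow_zero]
      ext i
      exact mem_leftAnnPow_zero.1 (hf i)
    | succ k ih =>
      intro f hf
      refine mem_leftAnnPow_succ.2 fun g hg => ih _ fun m => ?_
      rw [mem_coeffsIdeal] at hg
      rw [coeff_mul]
      refine finsum_induction (· ∈ leftAnnPow J.ideal k) (zero_mem _) (fun _ _ => add_mem)
        fun p => ?_
      exact zsmul_mem (mem_leftAnnPow_succ.1 (hf _) _ (J.iterate_mem (hg _) _)) _
  obtain ⟨k, hk⟩ := hJ
  refine ⟨k, key k 1 fun i => ?_⟩
  rw [coeff_one]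
  split_ifs
  · exact hk
  · exact zero_mem _

/-- The coefficients at `x^0` of the elements of degree at most `0` of an ideal: the ideal of
leading coefficients. -/
def leadingIdeal (I : TwoSidedIdeal (PseudoDiffOp δ)) : DeltaIdeal δ where
  ideal := TwoSidedIdeal.mk' {a | ∃ f ∈ I, (∀ i, 0 < i → f.coeff i = 0) ∧ f.coeff 0 = a}
    ⟨0, I.zero_mem, fun _ _ => rfl, rfl⟩
    (by
      rintro _ _ ⟨f, hf, hf0, rfl⟩ ⟨g, hg, hg0, rfl⟩
      exact ⟨f + g, I.add_mem hf hg, fun i hi => by rw [coeff_add, hf0 i hi, hg0 i hi, add_zero],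
        rfl⟩)
    (by
      rintro _ ⟨f, hf, hf0, rfl⟩
      exact ⟨-f, I.neg_mem hf, fun i hi => by rw [coeff_neg, hf0 i hi, neg_zero], rfl⟩)
    (by
      rintro a _ ⟨f, hf, hf0, rfl⟩
      exact ⟨monomial δ 0 a * f, I.mul_mem_left _ _ hf,
        fun i hi => by rw [coeff_monomial_zero_mul, hf0 i hi, mul_zero],
        coeff_monomial_zero_mul _ _ _⟩)
    (by
      rintro _ a ⟨f, hf, hf0, rfl⟩
      have ha : ∀ i, 0 < i → (monomial δ 0 a).coeff i = 0 := fun i hi => if_neg hi.ne'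
      exact ⟨f * monomial δ 0 a, I.mul_mem_right _ _ hf, coeff_mul_of_pos hf0 ha, by
        rw [coeff_mul_zero hf0 ha, coeff_monomial, if_pos rfl]⟩)
  map_mem := by
    intro a ha
    rw [TwoSidedIdeal.mem_mk'] at ha ⊢
    obtain ⟨f, hf, hf0, rfl⟩ := ha
    -- The commutator xf − fx lies in `I` and does not raise the degree, which gives stability under
    -- δ.
    have hc : ∀ i, (monomial δ 1 1 * f - f * monomial δ 1 1).coeff i = δ (f.coeff i) := fun i => by
      rw [coeff_sub, coeff_monomial_one_one_mul, coeff_mul_monomial_one, add_sub_cancel_left]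
    exact ⟨_, I.sub_mem (I.mul_mem_left (monomial δ 1 1) _ hf)
      (I.mul_mem_right _ (monomial δ 1 1) hf), fun i hi => by rw [hc, hf0 i hi, map_zero], hc 0⟩

theorem mem_leadingIdeal {I : TwoSidedIdeal (PseudoDiffOp δ)} {a : R} :
    a ∈ (leadingIdeal I).ideal ↔ ∃ f ∈ I, (∀ i, 0 < i → f.coeff i = 0) ∧ f.coeff 0 = a := by
  simp [leadingIdeal]

/-- A sequence of leading coefficients lifts to series in `I` of degree at most 0. Some finite
product of these vanishes, and its coefficient at x^0 is the product of the given elements. -/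
theorem isLeftTNilpotent_leadingIdeal {I : TwoSidedIdeal (PseudoDiffOp δ)}
    (hI : IsLeftTNilpotent (I : Set (PseudoDiffOp δ))) :
    IsLeftTNilpotent ((leadingIdeal I).ideal : Set R) := by
  intro s hs
  choose f hf hf0 hfs using fun n => mem_leadingIdeal.1 (hs n)
  obtain ⟨k, hk, h0⟩ := hI f hf
  refine ⟨k, hk, ?_⟩
  have := (coeff_prod_zero f hf0 k).2
  rw [h0] at this
  simpa [hfs, coeff_zero] using this.symm

/-- Multiplying by x^(-n) on the right moves the top term to degree 0, so considering only degree 0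
loses nothing. -/
theorem coeff_mem_leadingIdeal {I : TwoSidedIdeal (PseudoDiffOp δ)} {f : PseudoDiffOp δ}
    (hf : f ∈ I) {n : ℤ} (hn : ∀ i, n < i → f.coeff i = 0) :
    f.coeff n ∈ (leadingIdeal I).ideal := by
  refine mem_leadingIdeal.2 ⟨f * monomial δ (-n) 1, I.mul_mem_right _ _ hf, fun i hi => ?_, ?_⟩
  · rw [coeff_mul_monomial_one, hn _ (by omega)]
  · rw [coeff_mul_monomial_one, zero_sub, neg_neg]

/-- An ideal containing `J((x⁻¹; δ))` whose leading coefficients lie in `J` is `J((x⁻¹; δ))`. -/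
theorem coeff_mem_of_leadingIdeal_le {I : TwoSidedIdeal (PseudoDiffOp δ)} {J : DeltaIdeal δ}
    (hJ : coeffsIdeal J ≤ I) (hI : (leadingIdeal I).ideal ≤ J.ideal) {f : PseudoDiffOp δ}
    (hf : f ∈ I) (i : ℤ) : f.coeff i ∈ J.ideal := by
  -- Induction on the distance `d` below the degree bound; `f` and `n` vary because removing the
  -- leading term changes the series and lowers the bound.
  have key : ∀ (d : ℕ) (f : PseudoDiffOp δ), f ∈ I → ∀ n, (∀ i, n < i → f.coeff i = 0) →
      f.coeff (n - d) ∈ J.ideal := by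
    intro d
    induction d with
    | zero =>
      intro f hf n hn
      simpa using hI (coeff_mem_leadingIdeal hf hn)
    | succ d ih =>
      intro f hf n hn
      -- This is where `hJ` is needed: in general an ideal need not contain the leading monomials of
      -- its elements.
      have hm : monomial δ n (f.coeff n) ∈ I := hJ <| mem_coeffsIdeal.2 fun i => by
        rw [coeff_monomial]
        split_ifs
        · exact hI (coeff_mem_leadingIdeal hf hn)
        · exact J.ideal.zero_mem
      have := ih _ (I.sub_mem hf hm) (n - 1) fun i hi => by
        rw [coeff_sub, coeff_monomial]
        split_ifs with h
        · rw [h, sub_self]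
        · rw [hn i (by omega), sub_zero]
      rw [coeff_sub, coeff_monomial, if_neg (by omega), sub_zero] at this
      convert this using 2
      push_cast
      ring
  obtain ⟨n, hn⟩ := f.bdd
  rcases lt_or_ge n i with h | h
  · rw [hn i h]
    exact J.ideal.zero_mem
  · have := key (n - i).toNat f hf n hn
    rwa [Int.toNat_of_nonneg (by omega), sub_sub_cancel] at this

end PseudoDiffOp

/-! ### The first radideal and the transfinite induction -/

section Main

variable {R : Type u} [Ring R]

/-- Each element `a` belongs to its own left T-nilpotent right ideal (the term j = 0), and the
constant sequence `a` shows it nilpotent; Levitzki's theorem does the rest. -/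
theorem isNilpotentIdeal_deltaRadideal (δ : RingDerivation R)
    (hR : IsNoetherianRing R ∨ IsNoetherianRing Rᵐᵒᵖ) :
    (deltaRadideal δ).ideal.IsNilpotentIdeal :=
  TwoSidedIdeal.isNilpotentIdeal_of_nil hR fun _ hx =>
    ((mem_deltaRadideal δ).1 hx).isNilpotent (Submodule.subset_span ⟨0, rfl⟩)

theorem mem_leftTNilRadideal_pseudoDiffOp (δ : RingDerivation R)
    (hR : IsNoetherianRing R ∨ IsNoetherianRing Rᵐᵒᵖ) (f : PseudoDiffOp δ) :
    f ∈ leftTNilRadideal (PseudoDiffOp δ) ↔ ∀ i, f.coeff i ∈ (deltaRadideal δ).ideal := by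
  have hN := (PseudoDiffOp.isNilpotentIdeal_coeffsIdeal
    (isNilpotentIdeal_deltaRadideal δ hR)).isLeftTNilpotent
  rw [← PseudoDiffOp.mem_coeffsIdeal]
  constructor
  · refine fun hf => (sSup_le fun I hI => ?_ : leftTNilRadideal _ ≤ _) hf
    intro g hg
    -- Adding the nilpotent ideal of series over the δ-radideal makes the subtraction of leading
    -- terms legitimate while keeping left T-nilpotency.
    have hsup := IsLeftTNilpotent.sup hI hN
    refine PseudoDiffOp.mem_coeffsIdeal.2 (PseudoDiffOp.coeff_mem_of_leadingIdeal_le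
      (I := I ⊔ PseudoDiffOp.coeffsIdeal (deltaRadideal δ)) le_sup_right ?_
      ((le_sup_left : I ≤ _) hg))
    intro a ha
    exact (mem_deltaRadideal δ).2 ((isLeftTNilpotent_deltaRightIdeal_iff δ a).2
      ⟨_, PseudoDiffOp.isLeftTNilpotent_leadingIdeal hsup, ha⟩)
  · exact fun hf => (le_sSup hN : _ ≤ leftTNilRadideal _) hf

theorem TwoSidedIdeal.noetherian_quotient (hR : IsNoetherianRing R ∨ IsNoetherianRing Rᵐᵒᵖ)
    (I : TwoSidedIdeal R) :
    IsNoetherianRing I.ringCon.Quotient ∨ IsNoetherianRing I.ringCon.Quotientᵐᵒᵖ := by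
  refine hR.imp (fun h => ?_) fun h => ?_
  · exact isNoetherianRing_of_surjective (H := h) R _ I.ringCon.mk' (RingCon.mk'_surjective _)
  · refine isNoetherianRing_of_surjective (H := h) Rᵐᵒᵖ _ (RingHom.op I.ringCon.mk') fun y => ?_
    obtain ⟨x, hx⟩ := RingCon.mk'_surjective I.ringCon y.unop
    exact ⟨MulOpposite.op x, MulOpposite.unop_injective hx⟩

theorem mem_higherRadideal_pseudoDiffOp (δ : RingDerivation R)
    (hR : IsNoetherianRing R ∨ IsNoetherianRing Rᵐᵒᵖ) (α : Ordinal.{v}) (f : PseudoDiffOp δ) :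
    f ∈ higherRadideal (PseudoDiffOp δ) α ↔
      ∀ i, f.coeff i ∈ (deltaHigherRadideal δ α).ideal := by
  induction α using Ordinal.limitRecOn generalizing f with
  | zero =>
    rw [higherRadideal_zero, deltaHigherRadideal_zero, TwoSidedIdeal.mem_bot]
    simp only [TwoSidedIdeal.mem_bot]
    exact ⟨fun h i => by rw [h]; rfl, fun h => PseudoDiffOp.ext (funext h)⟩
  | add_one β ih =>
    -- By the inductive hypothesis the β-th radideal is the kernel of reduction modulo the β-th
    -- δ-ideal, so the case of the first radideal applies over the quotient ring.
    rw [mem_higherRadideal_add_one, mk_mem_leftTNilRadideal_iff _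
      (PseudoDiffOp.mapQuotient (deltaHigherRadideal δ β)) (PseudoDiffOp.mapQuotient_surjective _)
      fun g => by rw [PseudoDiffOp.mapQuotient_eq_zero_iff, ih],
      mem_leftTNilRadideal_pseudoDiffOp _ (TwoSidedIdeal.noetherian_quotient hR _)]
    exact forall_congr' fun i => (mem_deltaHigherRadideal_add_one δ β _).symm
  | limit β hβ ih =>
    rw [mem_higherRadideal_limit hβ]
    constructor
    · rintro ⟨γ, hγ, h⟩ i
      exact deltaHigherRadideal_mono δ hγ.le ((ih γ hγ f).1 h i)
    · intro h
      -- Each coefficient lies in some stage depending on its index. A maximal member of the chain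
      -- of δ-ideals below `β` contains every stage, hence all coefficients at once.
      have := TwoSidedIdeal.wellFoundedGT_of_noetherian hR
      obtain ⟨_, ⟨γ, hγ, rfl⟩, hmax⟩ := wellFounded_gt.has_min
        ((fun γ : Ordinal.{v} => (deltaHigherRadideal δ γ).ideal) '' Set.Iio β)
        ⟨_, 0, hβ.bot_lt, rfl⟩
      refine ⟨γ, hγ, (ih γ hγ f).2 fun i => ?_⟩
      obtain ⟨η, hη, hi⟩ := (mem_deltaHigherRadideal_limit δ hβ _).1 (h i)
      rcases le_total η γ with hle | hle
      · exact deltaHigherRadideal_mono δ hle hi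
      · have hle' := deltaHigherRadideal_mono δ hle
        rwa [hle'.eq_of_not_lt (hmax _ ⟨η, hη, rfl⟩)]

end Main

theorem proposition2p10 {R : Type u} [Ring R] (δ : RingDerivation R)
    (hR : IsNoetherianRing R ∨ IsNoetherianRing Rᵐᵒᵖ) (α : Ordinal.{v}) :
    (higherRadideal (PseudoDiffOp δ) α : Set (PseudoDiffOp δ)) =
      PseudoDiffOp.coeffsIn δ (deltaHigherRadideal δ α).ideal :=
  Set.ext fun f => mem_higherRadideal_pseudoDiffOp δ hR α f
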